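/- Let $\mathbb{G}=(\mathbb{R}^n,\circ,\delta_\lambda)$ be a stratified (homogeneous Carnot) group: $\mathbb{R}^n=\mathbb{R}^{N}\times\mathbb{R}^{N_2}\times\cdots\times\mathbb{R}^{N_r}$ with points $x=(x',x^{(2)},\ldots,x^{(r)})$ carries a Lie group law $\circ$ with neutral element $0$; for every $\lambda>0$ the dilation $\delta_\lambda(x)=(\lambda x',\lambda^2x^{(2)},\ldots,\lambda^r x^{(r)})$ is an automorphism of $\mathbb{G}$; and, if $X_1,\ldots,X_N$ denote the left-invariant vector fields with $X_k(0)=\partial/\partial x'_k|_0$, then the Lie algebra generated by $X_1,\ldots,X_N$ spans $\mathbb{R}^n$ at every point. Let $\mathcal{L}=\sum_{k=1}^N X_k^2$ be the sub-Laplacian, let $|x'|=\sqrt{x_1'^2+\cdots+x_N'^2}$, and let $dx$ be Lebesgue measure on $\mathbb{R}^n$. Let $\alpha\in\mathbb{R}$ with $\alpha>-2$ and $N>\alpha+4$. Then for every complex-valued $u\in C_0^\infty(\mathbb{G}\setminus\{x'=0\})$ both integrals below are finite and $$\int_{\mathbb{G}\setminus\{x'=0\}}\frac{|\mathcal{L}u|^2}{|x'|^{\alpha}}\,dx\;\ge\;\frac{(N+\alpha)^2(N-\alpha-4)^2}{16}\int_{\mathbb{G}\setminus\{x'=0\}}\frac{|u|^2}{|x'|^{\alpha+4}}\,dx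 .$$ -/

import Mathlib

open MeasureTheory
open scoped ContDiff

noncomputable section

/-- The space `ℝ^{d 0} × ⋯ × ℝ^{d r}` of points `x = (x', x^(2), …, x^(r+1))`; the coordinate
`x ⟨l, m⟩` is the `m`-th variable of the `(l+1)`-st stratum. Its `volume` is Lebesgue measure. -/
abbrev StratSpace {r : ℕ} (d : Fin (r + 1) → ℕ) : Type :=
  ((l : Fin (r + 1)) × Fin (d l)) → ℝ

/-- The dilation `δ_t (x', x^(2), …, x^(r+1)) = (t x', t² x^(2), …, t^(r+1) x^(r+1))`. -/
def dilation {r : ℕ} {d : Fin (r + 1) → ℕ} (t : ℝ) (x : StratSpace d) : StratSpace d :=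
  fun i => t ^ ((i.1 : ℕ) + 1) * x i

/-- The `k`-th Jacobian generator of a composition law with neutral element `0`: the left-invariant
vector field which equals `∂/∂x'_k` at `0`, i.e. the value at `x` is the image of the `k`-th basis
vector of the first stratum under the differential at `0` of the left translation by `x`. -/
def jacobianGenerator {r : ℕ} {d : Fin (r + 1) → ℕ}
    (mul : StratSpace d → StratSpace d → StratSpace d) (k : Fin (d 0)) :
    StratSpace d → StratSpace d :=
  fun x => fderiv ℝ (fun y => mul x y) 0 (Pi.single ⟨0, k⟩ 1)

/-- Membership in the Lie algebra of vector fields generated by the fields `X k`. -/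
inductive InLieAlgebraGenerated {E κ : Type} [NormedAddCommGroup E] [NormedSpace ℝ E]
    (X : κ → E → E) : (E → E) → Prop
  | generator (k : κ) : InLieAlgebraGenerated X (X k)
  | zero : InLieAlgebraGenerated X 0
  | add {V W : E → E} : InLieAlgebraGenerated X V → InLieAlgebraGenerated X W →
      InLieAlgebraGenerated X (V + W)
  | smul (c : ℝ) {V : E → E} : InLieAlgebraGenerated X V → InLieAlgebraGenerated X (c • V)
  | bracket {V W : E → E} : InLieAlgebraGenerated X V → InLieAlgebraGenerated X W →
      InLieAlgebraGenerated X (VectorField.lieBracket ℝ V W)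

/-- A stratified (homogeneous Carnot) group `(ℝⁿ, ∘, δ_t)`, `ℝⁿ = ℝ^{d 0} × ⋯ × ℝ^{d r}`: a Lie group
structure on `ℝⁿ` with neutral element `0`, for which every dilation `δ_t`, `t > 0`, is an
automorphism and whose Jacobian generators of the first stratum generate, as a Lie algebra, the
whole tangent space at every point. -/
structure StratifiedGroup {r : ℕ} (d : Fin (r + 1) → ℕ) where
  mul : StratSpace d → StratSpace d → StratSpace d
  inv : StratSpace d → StratSpace d
  mul_assoc : ∀ x y z, mul (mul x y) z = mul x (mul y z)
  zero_mul : ∀ x, mul 0 x = x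
  mul_zero : ∀ x, mul x 0 = x
  inv_mul_cancel : ∀ x, mul (inv x) x = 0
  contDiff_mul : ContDiff ℝ ∞ (fun p : StratSpace d × StratSpace d => mul p.1 p.2)
  contDiff_inv : ContDiff ℝ ∞ inv
  dilation_mul : ∀ t : ℝ, 0 < t → ∀ x y,
    dilation t (mul x y) = mul (dilation t x) (dilation t y)
  generates : ∀ x v : StratSpace d,
    ∃ V : StratSpace d → StratSpace d, InLieAlgebraGenerated (jacobianGenerator mul) V ∧ V x = v

namespace StratifiedGroup

variable {r : ℕ} {d : Fin (r + 1) → ℕ}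

/-- The derivative `X_k u` of `u` along the `k`-th Jacobian generator. -/
def X (G : StratifiedGroup d) (k : Fin (d 0)) (u : StratSpace d → ℂ) : StratSpace d → ℂ :=
  fun x => fderiv ℝ u x (jacobianGenerator G.mul k x)

/-- The sub-Laplacian `𝓛 = ∑_k X_k²`. -/
def subLaplacian (G : StratifiedGroup d) (u : StratSpace d → ℂ) : StratSpace d → ℂ :=
  fun x => ∑ k : Fin (d 0), G.X k (G.X k u) x

end StratifiedGroup

/-- The Euclidean norm `|x'|` of the first-stratum component of `x`. -/
def horizNorm {r : ℕ} {d : Fin (r + 1) → ℕ} (x : StratSpace d) : ℝ :=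
  √(∑ k : Fin (d 0), x ⟨0, k⟩ ^ 2)

/-- The open set `𝔾 ∖ {x' = 0}`. -/
def offVertical {r : ℕ} (d : Fin (r + 1) → ℕ) : Set (StratSpace d) :=
  {x | ¬ ∀ k : Fin (d 0), x ⟨0, k⟩ = 0}

end

/-! Homogeneity under dilations makes each `X_k` divergence-free for Lebesgue measure and forces
`X_k x'_j = δ_jk`, so on functions of `x'` the fields act as `∂/∂x'_k`. With `N = d 0`, `C =
(N+α)(N-α-4)/4` and `F_k = Re(X_k u · ū)|x'|^(-α-2) + ((N-2)/2)|u|² x'_k |x'|^(-α-4)`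
(`rellichFlux`), the integral of `∑ X_k F_k` is therefore zero. By `rellich_pointwise`,
`|𝓛u|²|x'|^(-α) - C²|u|²|x'|^(-α-4) + 2C ∑ X_k F_k` is a sum of squares with nonnegative weights:
one is `||x'|²𝓛u + Cu|²`, the others are the Hardy squares `||x'|² X_k u + ((N-α-4)/2) x'_k u|²`.
Integrating gives the inequality. -/

noncomputable section

section DivergenceFree

variable {ι : Type*} [Fintype ι] [DecidableEq ι]

/-- A `C¹` vector field whose diagonal partial derivatives vanish is skew for Lebesgue measure:
the derivative along it of a compactly supported `C¹` function has integral zero. -/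
theorem integral_fderiv_apply_eq_zero_of_diagonal {a : (ι → ℝ) → ι → ℝ} (ha : ContDiff ℝ 1 a)
    (hdiag : ∀ x i, fderiv ℝ (fun y => a y i) x (Pi.single i 1) = 0)
    {f : (ι → ℝ) → ℝ} (hf : ContDiff ℝ 1 f) (hfc : HasCompactSupport f) :
    Integrable (fun x => fderiv ℝ f x (a x)) ∧ ∫ x, fderiv ℝ f x (a x) = 0 := by
  have hai : ∀ i, ContDiff ℝ 1 (fun y => a y i) := fun i => contDiff_pi.1 ha i
  have hf' : Continuous (fderiv ℝ f) := hf.continuous_fderiv one_ne_zero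
  have hfc' : ∀ v, HasCompactSupport (fun x => fderiv ℝ f x v) := fun v => hfc.fderiv_apply ℝ v
  have hint : ∀ i, Integrable (fun x => a x i * fderiv ℝ f x (Pi.single i 1)) := fun i =>
    ((hai i).continuous.mul (hf'.clm_apply continuous_const)).integrable_of_hasCompactSupport
      (hfc' _).mul_left
  have hexp : (fun x => fderiv ℝ f x (a x)) =
      fun x => ∑ i, a x i * fderiv ℝ f x (Pi.single i 1) := by
    funext x
    conv_lhs => rw [pi_eq_sum_univ' (a x)]
    simp [map_sum, Pi.single]
  rw [hexp]
  refine ⟨integrable_finsetSum _ fun i _ => hint i, ?_⟩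
  rw [integral_finsetSum _ fun i _ => hint i]
  refine Finset.sum_eq_zero fun i _ => ?_
  rw [integral_mul_fderiv_eq_neg_fderiv_mul_of_integrable _ (hint i) _
    (fun x _ => (hai i).differentiable one_ne_zero x)
    (fun x _ => hf.differentiable one_ne_zero x)]
  · simp [hdiag]
  · simp [hdiag]
  · exact ((hai i).continuous.mul hf.continuous).integrable_of_hasCompactSupport hfc.mul_left

end DivergenceFree

/-! ### Homogeneity of the Jacobian generators -/

namespace StratifiedGroup

variable {r : ℕ} {d : Fin (r + 1) → ℕ} (G : StratifiedGroup d)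

theorem contDiff_jacobianGenerator (k : Fin (d 0)) : ContDiff ℝ ∞ (jacobianGenerator G.mul k) := by
  have h : ContDiff ℝ ∞ (fun x => fderiv ℝ (G.mul x) (0 : StratSpace d)) :=
    ContDiff.fderiv (f := G.mul) (n := ∞) G.contDiff_mul contDiff_const (by simp)
  exact h.clm_apply contDiff_const

/-- The dilation as a continuous linear map. -/
def dilationCLM (d : Fin (r + 1) → ℕ) (t : ℝ) : StratSpace d →L[ℝ] StratSpace d :=
  ContinuousLinearMap.pi fun i => t ^ ((i.1 : ℕ) + 1) • ContinuousLinearMap.proj i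

theorem dilationCLM_apply (t : ℝ) (x : StratSpace d) : dilationCLM d t x = dilation t x := rfl

theorem dilationCLM_single (t : ℝ) (i : (l : Fin (r + 1)) × Fin (d l)) :
    dilationCLM d t (Pi.single i 1) = t ^ ((i.1 : ℕ) + 1) • Pi.single i (1 : ℝ) := by
  funext j
  rcases eq_or_ne j i with rfl | h
  · simp [dilationCLM_apply, dilation]
  · simp [dilationCLM_apply, dilation, h]

/-- The component of a Jacobian generator in the stratum of weight `w` is homogeneous of
degree `w - 1`. -/
theorem jacobianGenerator_dilation (k : Fin (d 0)) {t : ℝ} (ht : 0 < t) (x : StratSpace d)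
    (i : (l : Fin (r + 1)) × Fin (d l)) :
    jacobianGenerator G.mul k (dilationCLM d t x) i =
      t ^ (i.1 : ℕ) * jacobianGenerator G.mul k x i := by
  have hd : ∀ x : StratSpace d, DifferentiableAt ℝ (G.mul x) 0 := fun x =>
    (G.contDiff_mul.comp (contDiff_prodMk_right x)).differentiable (by simp) 0
  have h1 : HasFDerivAt (fun y => dilationCLM d t (G.mul x y))
      ((dilationCLM d t).comp (fderiv ℝ (G.mul x) 0)) 0 :=
    (dilationCLM d t).hasFDerivAt.comp 0 (hd x).hasFDerivAt
  have h2 : HasFDerivAt (fun y => G.mul (dilationCLM d t x) (dilationCLM d t y))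
      ((fderiv ℝ (G.mul (dilationCLM d t x)) 0).comp (dilationCLM d t)) 0 := by
    refine HasFDerivAt.comp (g := G.mul (dilationCLM d t x)) 0 ?_ (dilationCLM d t).hasFDerivAt
    rw [map_zero]
    exact (hd _).hasFDerivAt
  -- The automorphism identity is differentiated at `y = 0`; since `δ_t` scales the `k`-th
  -- first-stratum basis vector by `t`, one power of `t` cancels.
  have he : (fun y => G.mul (dilationCLM d t x) (dilationCLM d t y)) =
      fun y => dilationCLM d t (G.mul x y) := by
    funext y
    exact (G.dilation_mul t ht x y).symm
  rw [he] at h2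
  have h3 := congrArg (fun A => A (Pi.single ⟨0, k⟩ 1) i) (h2.unique h1)
  simp only [ContinuousLinearMap.comp_apply, dilationCLM_single, map_smul, Pi.smul_apply,
    smul_eq_mul] at h3
  have h4 : t * jacobianGenerator G.mul k (dilationCLM d t x) i =
      t * (t ^ (i.1 : ℕ) * jacobianGenerator G.mul k x i) := by
    refine Eq.trans ?_ (h3.trans ?_)
    · simp [jacobianGenerator]
    · simp only [dilationCLM_apply, dilation, jacobianGenerator]
      ring
  exact mul_left_cancel₀ ht.ne' h4

theorem tendsto_dilation_zero (x : StratSpace d) :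
    Filter.Tendsto (fun t : ℝ => dilationCLM d t x) (nhdsWithin 0 (Set.Ioi 0)) (nhds 0) := by
  have h : Continuous (fun t : ℝ => dilationCLM d t x) := by
    refine continuous_pi fun i => ?_
    simp only [dilationCLM_apply, dilation]
    fun_prop
  have h0 := (h.tendsto 0).mono_left (nhdsWithin_le_nhds (s := Set.Ioi 0))
  convert h0
  funext i
  simp [dilationCLM_apply, dilation]

/-- The generators of the first stratum have constant first-stratum part. -/
theorem jacobianGenerator_horizontal (k j : Fin (d 0)) (x : StratSpace d) :
    jacobianGenerator G.mul k x ⟨0, j⟩ = if j = k then 1 else 0 := by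
  have hc : Continuous (fun y => jacobianGenerator G.mul k y ⟨0, j⟩) :=
    (continuous_apply _).comp (G.contDiff_jacobianGenerator k).continuous
  -- A continuous function homogeneous of degree `0` equals its value at the origin, by `t → 0+`;
  -- there left translation is the identity.
  have h1 := (hc.tendsto 0).comp (tendsto_dilation_zero x)
  have h2 : Filter.Tendsto ((fun y => jacobianGenerator G.mul k y ⟨0, j⟩) ∘
      fun t : ℝ => dilationCLM d t x) (nhdsWithin 0 (Set.Ioi 0))
      (nhds (jacobianGenerator G.mul k x ⟨0, j⟩)) := by
    refine tendsto_const_nhds.congr' ?_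
    filter_upwards [self_mem_nhdsWithin] with t ht
    simp [G.jacobianGenerator_dilation k ht x]
  rw [tendsto_nhds_unique h2 h1]
  have h0 : (fun y => G.mul 0 y) = id := funext G.zero_mul
  simp only [jacobianGenerator, h0, fderiv_id, ContinuousLinearMap.id_apply]
  rcases eq_or_ne j k with rfl | h
  · simp
  · simp [h]

/-- The diagonal partial derivatives of the Jacobian generators vanish. -/
theorem fderiv_jacobianGenerator_diagonal (k : Fin (d 0)) (x : StratSpace d)
    (i : (l : Fin (r + 1)) × Fin (d l)) :
    fderiv ℝ (fun y => jacobianGenerator G.mul k y i) x (Pi.single i 1) = 0 := by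
  set g : StratSpace d → ℝ := fun y => jacobianGenerator G.mul k y i with hg
  have hgs : ContDiff ℝ ∞ g := contDiff_pi.1 (G.contDiff_jacobianGenerator k) i
  have hgd : Differentiable ℝ g := hgs.differentiable (by simp)
  -- The component has degree one less than the weight of the variable `x_i`, so its
  -- `x_i`-derivative has degree `-1`; continuity at `0` then makes it vanish.
  have hscale : ∀ t : ℝ, 0 < t →
      t * fderiv ℝ g (dilationCLM d t x) (Pi.single i 1) = fderiv ℝ g x (Pi.single i 1) := by
    intro t ht
    have h1 : HasFDerivAt (fun y => g (dilationCLM d t y))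
        ((fderiv ℝ g (dilationCLM d t x)).comp (dilationCLM d t)) x :=
      HasFDerivAt.comp x (hgd _).hasFDerivAt (dilationCLM d t).hasFDerivAt
    have h2 : HasFDerivAt (fun y => t ^ (i.1 : ℕ) * g y) (t ^ (i.1 : ℕ) • fderiv ℝ g x) x :=
      (hgd x).hasFDerivAt.const_mul _
    have he : (fun y => g (dilationCLM d t y)) = fun y => t ^ (i.1 : ℕ) * g y :=
      funext fun y => G.jacobianGenerator_dilation k ht y i
    rw [he] at h1
    have h3 := congrArg (fun A => A (Pi.single i 1)) (h1.unique h2)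
    simp only [ContinuousLinearMap.comp_apply, dilationCLM_single, map_smul, smul_eq_mul,
      smul_apply, pow_succ, _root_.mul_assoc] at h3
    exact mul_left_cancel₀ (pow_pos ht _).ne' h3
  have hc : Continuous (fun y => fderiv ℝ g y (Pi.single i 1)) :=
    (hgs.continuous_fderiv (by simp)).clm_apply continuous_const
  have h1 : Filter.Tendsto (fun t : ℝ => t * fderiv ℝ g (dilationCLM d t x) (Pi.single i 1))
      (nhdsWithin 0 (Set.Ioi 0)) (nhds (0 * fderiv ℝ g 0 (Pi.single i 1))) :=
    (Filter.tendsto_id.mono_left nhdsWithin_le_nhds).mul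
      ((hc.tendsto 0).comp (tendsto_dilation_zero x))
  rw [MulZeroClass.zero_mul] at h1
  refine tendsto_nhds_unique (tendsto_const_nhds.congr' ?_) h1
  filter_upwards [self_mem_nhdsWithin] with t ht using (hscale t ht).symm

variable {G} in
theorem contDiff_X (k : Fin (d 0)) {u : StratSpace d → ℂ} (hu : ContDiff ℝ ∞ u) :
    ContDiff ℝ ∞ (G.X k u) :=
  (hu.fderiv_right (m := ∞) (by simp)).clm_apply (G.contDiff_jacobianGenerator k)

theorem tsupport_X_subset (k : Fin (d 0)) (u : StratSpace d → ℂ) :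
    tsupport (G.X k u) ⊆ tsupport u := by
  refine closure_minimal (fun x hx => ?_) (isClosed_tsupport u)
  refine support_fderiv_subset ℝ (fun h => hx ?_)
  simp [X, h]

theorem contDiff_subLaplacian {u : StratSpace d → ℂ} (hu : ContDiff ℝ ∞ u) :
    ContDiff ℝ ∞ (G.subLaplacian u) :=
  ContDiff.sum fun k _ => contDiff_X k (contDiff_X k hu)

theorem tsupport_subLaplacian_subset (u : StratSpace d → ℂ) :
    tsupport (G.subLaplacian u) ⊆ tsupport u := by
  refine closure_minimal (fun x hx => ?_) (isClosed_tsupport u)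
  by_contra h
  refine hx (Finset.sum_eq_zero fun k _ => ?_)
  exact image_eq_zero_of_notMem_tsupport fun hk =>
    h (G.tsupport_X_subset k u (G.tsupport_X_subset k _ hk))

end StratifiedGroup

/-! ### Powers of `|x'|` as weights -/

section Weights

variable {r : ℕ} {d : Fin (r + 1) → ℕ}

/-- The square `|x'|²`. -/
def horizSq (x : StratSpace d) : ℝ := ∑ k : Fin (d 0), x ⟨0, k⟩ ^ 2

theorem horizSq_nonneg (x : StratSpace d) : 0 ≤ horizSq x :=
  Finset.sum_nonneg fun _ _ => sq_nonneg _

theorem horizSq_pos {x : StratSpace d} (hx : x ∈ offVertical d) : 0 < horizSq x := by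
  simp only [offVertical, Set.mem_ofPred_eq, not_forall] at hx
  obtain ⟨k, hk⟩ := hx
  exact Finset.sum_pos' (fun j _ => sq_nonneg _) ⟨k, Finset.mem_univ k, by positivity⟩

theorem horizNorm_rpow (x : StratSpace d) (s : ℝ) : horizNorm x ^ s = horizSq x ^ (s / 2) := by
  have h := horizSq_nonneg x
  rw [horizNorm, ← horizSq, Real.sqrt_eq_rpow, ← Real.rpow_mul h]
  congr 1
  ring

theorem contDiff_horizSq : ContDiff ℝ ∞ (horizSq : StratSpace d → ℝ) :=
  ContDiff.sum fun _ _ => (contDiff_apply ℝ ℝ _).pow 2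

theorem contDiffAt_horizSq_rpow {x : StratSpace d} (hx : x ∈ offVertical d) (s : ℝ) :
    ContDiffAt ℝ ∞ (fun y => horizSq y ^ s) x :=
  contDiff_horizSq.contDiffAt.rpow_const_of_ne (horizSq_pos hx).ne'

/-- A function supported away from `{x' = 0}` may be multiplied by any power of `|x'|`. -/
theorem contDiff_mul_horizSq_rpow {f : StratSpace d → ℝ} (hf : ContDiff ℝ ∞ f)
    (hs : tsupport f ⊆ offVertical d) (s : ℝ) :
    ContDiff ℝ ∞ (fun x => f x * horizSq x ^ s) := by
  refine contDiff_iff_contDiffAt.2 fun x => ?_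
  by_cases hx : x ∈ tsupport f
  · exact hf.contDiffAt.mul (contDiffAt_horizSq_rpow (hs hx) s)
  · refine contDiffAt_const (c := (0 : ℝ)) |>.congr_of_eventuallyEq ?_
    filter_upwards [notMem_tsupport_iff_eventuallyEq.1 hx] with y hy
    simp [hy]

theorem hasFDerivAt_horizSq (x : StratSpace d) :
    HasFDerivAt horizSq (∑ k : Fin (d 0), (2 * x ⟨0, k⟩) •
      (ContinuousLinearMap.proj ⟨0, k⟩ : StratSpace d →L[ℝ] ℝ)) x := by
  refine HasFDerivAt.fun_sum fun k _ => ?_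
  have h : HasFDerivAt (fun y : StratSpace d => y ⟨0, k⟩) (ContinuousLinearMap.proj ⟨0, k⟩ :
    StratSpace d →L[ℝ] ℝ) x := hasFDerivAt_apply _ _
  simpa using h.pow 2

end Weights

/-- The algebraic core of the weighted Rellich inequality. -/
theorem rellich_pointwise {κ : Type*} [Fintype κ] (ξ : κ → ℝ) (w : ℂ) (z y : κ → ℂ)
    {P R α : ℝ} (hP : 0 < P) (hR : 0 ≤ R) (hPξ : P = ∑ k, ξ k ^ 2)
    (hC : 0 ≤ ((Fintype.card κ : ℝ) + α) * ((Fintype.card κ : ℝ) - α - 4) / 4) :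
    -(2 * (((Fintype.card κ : ℝ) + α) * ((Fintype.card κ : ℝ) - α - 4) / 4)) *
      ∑ k, ((inner ℝ (y k) w + inner ℝ (z k) (z k)) * (P * (P * R))
        + inner ℝ (z k) w * (-(α + 2) * ξ k * (P * R))
        + ((Fintype.card κ : ℝ) - 2) / 2 * (2 * inner ℝ w (z k) * ξ k * (P * R)
          + ‖w‖ ^ 2 * (P * R) + ‖w‖ ^ 2 * ξ k * (-(α + 4) * ξ k * R)))
    ≤ ‖∑ k, y k‖ ^ 2 * (P * (P * (P * R)))
      - ((Fintype.card κ : ℝ) + α) ^ 2 * ((Fintype.card κ : ℝ) - α - 4) ^ 2 / 16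
        * (‖w‖ ^ 2 * (P * R)) := by
  set N : ℝ := (Fintype.card κ : ℝ) with hN
  set C : ℝ := (N + α) * (N - α - 4) / 4 with hCdef
  set S : ℝ := ∑ k, ‖z k‖ ^ 2 with hS
  set T : ℝ := ∑ k, ξ k * inner ℝ (z k) w with hT
  set I : ℝ := inner ℝ (∑ k, y k) w with hI
  have hsum : ∑ k, ((inner ℝ (y k) w + inner ℝ (z k) (z k)) * (P * (P * R))
        + inner ℝ (z k) w * (-(α + 2) * ξ k * (P * R))
        + (N - 2) / 2 * (2 * inner ℝ w (z k) * ξ k * (P * R)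
          + ‖w‖ ^ 2 * (P * R) + ‖w‖ ^ 2 * ξ k * (-(α + 4) * ξ k * R)))
      = P * R * (P * I + P * S + (N - α - 4) * T + (N - 2) / 2 * (N - α - 4) * ‖w‖ ^ 2) := by
    have hterm : ∀ k, ((inner ℝ (y k) w + inner ℝ (z k) (z k)) * (P * (P * R))
        + inner ℝ (z k) w * (-(α + 2) * ξ k * (P * R))
        + (N - 2) / 2 * (2 * inner ℝ w (z k) * ξ k * (P * R)
          + ‖w‖ ^ 2 * (P * R) + ‖w‖ ^ 2 * ξ k * (-(α + 4) * ξ k * R)))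
        = P * (P * R) * inner ℝ (y k) w + P * (P * R) * ‖z k‖ ^ 2
          + P * R * (N - α - 4) * (ξ k * inner ℝ (z k) w)
          + (N - 2) / 2 * ‖w‖ ^ 2 * (P * R)
          + -((N - 2) / 2 * ‖w‖ ^ 2 * (α + 4) * R) * ξ k ^ 2 := by
      intro k
      rw [real_inner_self_eq_norm_sq, real_inner_comm (z k) w]
      ring
    simp only [hterm, Finset.sum_add_distrib, ← Finset.mul_sum]
    rw [← hPξ, ← hS, ← hT, ← sum_inner, ← hI, Finset.sum_const, Finset.card_univ, nsmul_eq_mul,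
      ← hN]
    ring
  -- The Hardy squares sum to `P` times this quantity, because `∑ ξ_k² = P`.
  have hhardy : 0 ≤ P * S + (N - α - 4) * T + (N - α - 4) ^ 2 / 4 * ‖w‖ ^ 2 := by
    have h : 0 ≤ ∑ k, ‖P • z k + ((N - α - 4) / 2 * ξ k) • w‖ ^ 2 :=
      Finset.sum_nonneg fun k _ => sq_nonneg _
    have he : ∀ k, ‖P • z k + ((N - α - 4) / 2 * ξ k) • w‖ ^ 2 = P ^ 2 * ‖z k‖ ^ 2
        + P * (N - α - 4) * (ξ k * inner ℝ (z k) w)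
        + (N - α - 4) ^ 2 / 4 * ‖w‖ ^ 2 * ξ k ^ 2 := by
      intro k
      rw [norm_add_sq_real, norm_smul, norm_smul, real_inner_smul_left, real_inner_smul_right,
        mul_pow, mul_pow, Real.norm_eq_abs, Real.norm_eq_abs, sq_abs, sq_abs]
      ring
    simp only [he, Finset.sum_add_distrib, ← Finset.mul_sum] at h
    rw [← hPξ, ← hS, ← hT] at h
    refine (mul_nonneg_iff_of_pos_left hP).1 ?_
    linarith
  have hcs : 0 ≤ P ^ 2 * ‖∑ k, y k‖ ^ 2 + 2 * (P * C) * I + C ^ 2 * ‖w‖ ^ 2 := by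
    have h : 0 ≤ ‖P • (∑ k, y k) + C • w‖ ^ 2 := sq_nonneg _
    rw [norm_add_sq_real, norm_smul, norm_smul, real_inner_smul_left, real_inner_smul_right,
        mul_pow, mul_pow, Real.norm_eq_abs, Real.norm_eq_abs, sq_abs, sq_abs] at h
    linarith
  rw [hsum]
  have hPR : 0 ≤ P * R := mul_nonneg hP.le hR
  have h1 := mul_nonneg hPR hcs
  have h2 := mul_nonneg (mul_nonneg hPR hC) hhardy
  have hCsq : (N + α) ^ 2 * (N - α - 4) ^ 2 / 16 = C ^ 2 := by rw [hCdef]; ring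
  -- This identity dictates the coefficient `(N-2)/2` in the flux: the Hardy squares absorb
  -- `(N-α-4)²/4` and leave exactly `C`. The two sides of the goal then differ by `P * R` times
  -- (`hcs` plus `2C` times `hhardy`).
  have hCm : (N - 2) / 2 * (N - α - 4) = (N - α - 4) ^ 2 / 4 + C := by rw [hCdef]; ring
  rw [hCsq, hCm]
  linarith

/-! ### The flux and its horizontal divergence -/

namespace StratifiedGroup

variable {r : ℕ} {d : Fin (r + 1) → ℕ} (G : StratifiedGroup d)

/-- The `k`-th component of the horizontal field whose divergence controls the Rellich
inequality. -/
def rellichFlux (α : ℝ) (u : StratSpace d → ℂ) (k : Fin (d 0)) (x : StratSpace d) : ℝ :=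
  inner ℝ (G.X k u x) (u x) * horizSq x ^ (-(α / 2) - 1) +
    ((d 0 : ℝ) - 2) / 2 * (‖u x‖ ^ 2 * x ⟨0, k⟩ * horizSq x ^ (-(α / 2) - 2))

variable {u : StratSpace d → ℂ}

theorem contDiff_rellichFlux (α : ℝ) (hu : ContDiff ℝ ∞ u) (hsupp : tsupport u ⊆ offVertical d)
    (k : Fin (d 0)) : ContDiff ℝ ∞ (G.rellichFlux α u k) := by
  refine (contDiff_mul_horizSq_rpow ((contDiff_X k hu).inner ℝ hu) ?_ _).add
    (contDiff_const.mul (contDiff_mul_horizSq_rpow ((hu.norm_sq ℝ).mul (contDiff_apply ℝ ℝ _))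
      ?_ _))
  · refine (closure_mono fun x hx => ?_).trans hsupp
    intro h
    simp [h] at hx
  · refine (closure_mono fun x hx => ?_).trans hsupp
    intro h
    simp [h] at hx

theorem hasCompactSupport_rellichFlux (α : ℝ) (hcs : HasCompactSupport u) (k : Fin (d 0)) :
    HasCompactSupport (G.rellichFlux α u k) := by
  refine hcs.mono fun x hx h => hx ?_
  simp [rellichFlux, h]

/-- This is the product rule with `X_k x'_k = 1` and `X_k |x'|² = 2 x'_k`. All weights are expressed
through the lowest power `|x'|^(-α-6)`, the `R` of `rellich_pointwise`, so that the comparison there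
is polynomial. -/
theorem fderiv_rellichFlux (α : ℝ) (hu : ContDiff ℝ ∞ u) (k : Fin (d 0)) {x : StratSpace d}
    (hx : x ∈ offVertical d) :
    fderiv ℝ (G.rellichFlux α u k) x (jacobianGenerator G.mul k x) =
      (inner ℝ (G.X k (G.X k u) x) (u x) + inner ℝ (G.X k u x) (G.X k u x))
          * (horizSq x * (horizSq x * horizSq x ^ (-(α / 2) - 3)))
        + inner ℝ (G.X k u x) (u x)
          * (-(α + 2) * x ⟨0, k⟩ * (horizSq x * horizSq x ^ (-(α / 2) - 3)))
        + ((d 0 : ℝ) - 2) / 2 * (2 * inner ℝ (u x) (G.X k u x) * x ⟨0, k⟩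
            * (horizSq x * horizSq x ^ (-(α / 2) - 3))
          + ‖u x‖ ^ 2 * (horizSq x * horizSq x ^ (-(α / 2) - 3))
          + ‖u x‖ ^ 2 * x ⟨0, k⟩ * (-(α + 4) * x ⟨0, k⟩ * horizSq x ^ (-(α / 2) - 3))) := by
  have hP := horizSq_pos hx
  have hud := (hu.differentiable (by simp) x).hasFDerivAt
  have hXd := ((contDiff_X (G := G) k hu).differentiable (by simp) x).hasFDerivAt
  have hc : HasFDerivAt (fun y : StratSpace d => y ⟨0, k⟩) (ContinuousLinearMap.proj ⟨0, k⟩ :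
    StratSpace d →L[ℝ] ℝ) x := hasFDerivAt_apply _ _
  have hr : ∀ s : ℝ, HasFDerivAt (fun y : StratSpace d => horizSq y ^ s) _ x := fun s =>
    (hasFDerivAt_horizSq x).rpow_const (p := s) (Or.inl hP.ne')
  have hF : HasFDerivAt (G.rellichFlux α u k) _ x :=
    ((hXd.inner ℝ hud).mul (hr (-(α / 2) - 1))).add
      ((((hud.norm_sq).mul hc).mul (hr (-(α / 2) - 2))).const_mul (((d 0 : ℝ) - 2) / 2))
  have hu1 : fderiv ℝ u x (jacobianGenerator G.mul k x) = G.X k u x := rfl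
  have hu2 : fderiv ℝ (G.X k u) x (jacobianGenerator G.mul k x) = G.X k (G.X k u) x := rfl
  have hstep : ∀ s t : ℝ, s = 1 + t → horizSq x ^ s = horizSq x * horizSq x ^ t := by
    rintro s t rfl
    rw [Real.rpow_add hP, Real.rpow_one]
  have e1 := hstep (-(α / 2) - 2) (-(α / 2) - 3) (by ring)
  have e2 := hstep (-(α / 2) - 1) (-(α / 2) - 2) (by ring)
  rw [hF.fderiv]
  have e3 : -(α / 2) - 1 - 1 = -(α / 2) - 2 := by ring
  have e4 : -(α / 2) - 2 - 1 = -(α / 2) - 3 := by ring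
  simp [fderivInnerCLM_apply, hu1, hu2, e3, e4, e2, e1, G.jacobianGenerator_horizontal]
  ring

theorem integrable_weighted {f : StratSpace d → ℂ} (hf : ContDiff ℝ ∞ f)
    (hcs : HasCompactSupport f) (hsupp : tsupport f ⊆ offVertical d) (s : ℝ) :
    Integrable (fun x => ‖f x‖ ^ 2 / horizNorm x ^ s) := by
  have he : (fun x => ‖f x‖ ^ 2 / horizNorm x ^ s) =
      fun x => ‖f x‖ ^ 2 * horizSq x ^ (-(s / 2)) := by
    funext x
    rw [horizNorm_rpow, Real.rpow_neg (horizSq_nonneg x), div_eq_mul_inv]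
  rw [he]
  refine (contDiff_mul_horizSq_rpow (hf.norm_sq ℝ) ?_ _).continuous.integrable_of_hasCompactSupport
    (hcs.mono fun x hx h => hx (by simp [h]))
  refine (closure_mono fun x hx => ?_).trans hsupp
  intro h
  simp [h] at hx

end StratifiedGroup

end

theorem corollary3p2 {r : ℕ} {d : Fin (r + 1) → ℕ} (G : StratifiedGroup d) (α : ℝ)
    (hα : -2 < α) (hN : α + 4 < (d 0 : ℝ))
    (u : StratSpace d → ℂ) (hu : ContDiff ℝ ∞ u) (hcs : HasCompactSupport u)
    (hsupp : tsupport u ⊆ offVertical d) :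
    IntegrableOn (fun x => ‖G.subLaplacian u x‖ ^ 2 / horizNorm x ^ α) (offVertical d) ∧
    IntegrableOn (fun x => ‖u x‖ ^ 2 / horizNorm x ^ (α + 4)) (offVertical d) ∧
    ((d 0 : ℝ) + α) ^ 2 * ((d 0 : ℝ) - α - 4) ^ 2 / 16 *
        ∫ x in offVertical d, ‖u x‖ ^ 2 / horizNorm x ^ (α + 4) ≤
      ∫ x in offVertical d, ‖G.subLaplacian u x‖ ^ 2 / horizNorm x ^ α := by
  have hLs := G.tsupport_subLaplacian_subset u
  have hL : Integrable (fun x => ‖G.subLaplacian u x‖ ^ 2 / horizNorm x ^ α) :=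
    StratifiedGroup.integrable_weighted (G.contDiff_subLaplacian hu)
      (hcs.of_isClosed_subset (isClosed_tsupport _) hLs) (hLs.trans hsupp) α
  have hU : Integrable (fun x => ‖u x‖ ^ 2 / horizNorm x ^ (α + 4)) :=
    StratifiedGroup.integrable_weighted hu hcs hsupp (α + 4)
  refine ⟨hL.integrableOn, hU.integrableOn, ?_⟩
  have hu0 : ∀ x, x ∉ tsupport u → u x = 0 := fun x hx => image_eq_zero_of_notMem_tsupport hx
  have hL0 : ∀ x, x ∉ tsupport u → G.subLaplacian u x = 0 := fun x hx =>
    image_eq_zero_of_notMem_tsupport fun h => hx (hLs h)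
  rw [setIntegral_eq_integral_of_forall_compl_eq_zero fun x hx => by
      simp [hu0 x fun h => hx (hsupp h)],
    setIntegral_eq_integral_of_forall_compl_eq_zero fun x hx => by
      simp [hL0 x fun h => hx (hsupp h)]]
  set C : ℝ := ((d 0 : ℝ) + α) * ((d 0 : ℝ) - α - 4) / 4 with hC
  -- The two hypotheses on `α` give `N + α > 2α + 4 > 0`.
  have hC0 : 0 ≤ C :=
    div_nonneg (mul_nonneg (by linarith) (by linarith)) (by norm_num)
  have hdiv : ∀ k, _ := fun k => integral_fderiv_apply_eq_zero_of_diagonal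
    ((G.contDiff_jacobianGenerator k).of_le (by simp)) (G.fderiv_jacobianGenerator_diagonal k)
    ((G.contDiff_rellichFlux α hu hsupp k).of_le (by simp))
    (G.hasCompactSupport_rellichFlux α hcs k)
  have hmono : ∫ x, -(2 * C) * ∑ k, fderiv ℝ (G.rellichFlux α u k) x (jacobianGenerator G.mul k x)
      ≤ ∫ x, (‖G.subLaplacian u x‖ ^ 2 / horizNorm x ^ α
        - ((d 0 : ℝ) + α) ^ 2 * ((d 0 : ℝ) - α - 4) ^ 2 / 16
          * (‖u x‖ ^ 2 / horizNorm x ^ (α + 4))) := by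
    refine integral_mono ((integrable_finsetSum _ fun k _ => (hdiv k).1).const_mul _)
      (hL.sub (hU.const_mul _)) fun x => ?_
    by_cases hx : x ∈ tsupport u
    · have hxV := hsupp hx
      have hP := horizSq_pos hxV
      -- Used with `n = 3` for `|x'|^(-α)` and `n = 1` for `|x'|^(-α-4)`.
      have hw : ∀ (s : ℝ) (n : ℕ), s / 2 + n = α / 2 + 3 →
          (horizNorm x ^ s)⁻¹ = horizSq x ^ n * horizSq x ^ (-(α / 2) - 3) := by
        intro s n h
        rw [horizNorm_rpow, ← Real.rpow_neg hP.le, ← Real.rpow_natCast, ← Real.rpow_add hP]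
        congr 1
        linarith
      have key := rellich_pointwise (fun k => x ⟨0, k⟩) (u x) (fun k => G.X k u x)
        (fun k => G.X k (G.X k u) x) (α := α) hP
        (Real.rpow_nonneg hP.le (-(α / 2) - 3)) rfl (by simpa using hC0)
      simp only [Fintype.card_fin, ← G.fderiv_rellichFlux α hu _ hxV] at key
      rw [div_eq_mul_inv _ (horizNorm x ^ α), div_eq_mul_inv _ (horizNorm x ^ (α + 4)),
        hw α 3 (by push_cast; ring), hw (α + 4) 1 (by push_cast; ring)]
      refine key.trans_eq ?_
      simp only [StratifiedGroup.subLaplacian]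
      ring
    · have h0 : ∀ k, fderiv ℝ (G.rellichFlux α u k) x = 0 := by
        intro k
        refine image_eq_zero_of_notMem_tsupport fun h => hx ?_
        have hs : Function.support (G.rellichFlux α u k) ⊆ Function.support u := fun y hy h' =>
          hy (by simp [StratifiedGroup.rellichFlux, h'])
        exact closure_mono hs (tsupport_fderiv_subset ℝ h)
      simp [h0, hu0 x hx, hL0 x hx]
  -- The divergence side integrates to zero, leaving the difference of the two weighted integrals
  -- nonnegative.
  rw [integral_const_mul, integral_finsetSum _ fun k _ => (hdiv k).1,
    Finset.sum_eq_zero fun k _ => (hdiv k).2, mul_zero,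
    integral_sub hL (hU.const_mul _), integral_const_mul] at hmono
  linarith
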